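/- For $k\le\omega$ let $(\omega)^k$ be the set of partitions of $\omega$ into exactly $k$ nonempty blocks, each identified with the function $p:\omega\to k$ that sends $m$ to $i$ when $m$ lies in the $i$-th block, blocks being listed in the order of their least elements. For $p\in(\omega)^\omega$ let $(p)^2$ be the set of $q\in(\omega)^2$ such that every block of $p$ is contained in a block of $q$; $p$ is homogeneous for $S\subseteq(\omega)^2$ if $(p)^2\subseteq S$. For a finite string $\sigma$ that is an initial segment of some element of $(\omega)^2$ and in which both $0$ and $1$ appear, let $[\sigma]$ be the set of $p\in(\omega)^2$ that extend $\sigma$. Borel codes are labelled subtrees of $\omega^{<\omega}$. A Borel code for a $\Sigma^0_0$ or $\Pi^0_0$ set is a single root labelled by (a name for) one of the clopen sets $\emptyset$, $(\omega)^2$, $[\sigma]$, $(\omega)^2\setminus[\sigma]$, and represents that set. For finite $\alpha\ge 1$, a Borel code for a $\Sigma^0_\alpha$ (respectively $\Pi^0_\alpha$) set is a tree whose root is labelled $\cup$ (respectively $\cap$) and each of whose subtrees at level $1$ is a Borel code for a $\Sigma^0_\beta$ or a $\Pi^0_\beta$ set for some $\beta<\alpha$; it represents the union (respectively the intersection) of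 the sets represented by these subtrees. A code is computable if the tree together with its labelling is computable. Theorem. Let $n\in\omega$, and let $R\subseteq(\omega)^2$ be represented by a computable Borel code for a $\Sigma^0_{n+2}$ set. Then either there is a $\emptyset^{(n)}$-computable $x\in(\omega)^\omega$ that is homogeneous for $\overline{R}=(\omega)^2\setminus R$, or there is a $\emptyset^{(n+1)}$-computable $x\in(\omega)^\omega$ that is homogeneous for $R$. -/

import Mathlib

/-! ### Partitions of `ω` -/

namespace DualRamsey

/-- `p` is the canonical representation of a partition of `ω` into `k ≤ ω` nonempty blocks: it takes
values below `k`, it is ordered (every `j < p n` is already a value at some `m < n`), and it is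
surjective onto `k`. -/
def IsPartition (k : ℕ∞) (p : ℕ → ℕ) : Prop :=
  (∀ n, (p n : ℕ∞) < k) ∧ (∀ n, ∀ j < p n, ∃ m < n, p m = j) ∧
    ∀ i : ℕ, (i : ℕ∞) < k → ∃ n, p n = i

/-- The space `(ω)^k` of `k`-partitions of `ω`; `k = ⊤` gives the infinite partitions `(ω)^ω`. -/
abbrev Partition (k : ℕ∞) : Type := {p : ℕ → ℕ // IsPartition k p}

/-- The set `(p)^k` of `k`-coarsenings of the infinite partition `p`. -/
def coarsenings (p : Partition ⊤) (k : ℕ∞) : Set (Partition k) :=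
  {q | ∀ n m, p.1 n = p.1 m → q.1 n = q.1 m}

/-- `σ ∈ (ω)^k_fin`: the string `σ` is ordered, has entries below `k`, and every `i < k` appears. -/
def IsFinPartition (k : ℕ∞) (σ : List ℕ) : Prop :=
  (∀ a ∈ σ, (a : ℕ∞) < k) ∧ (∀ n (h : n < σ.length), ∀ j < σ[n], j ∈ σ.take n) ∧
    ∀ i : ℕ, (i : ℕ∞) < k → i ∈ σ

/-- The basic clopen set `[σ]` of all `p ∈ (ω)^k` that extend the string `σ`. -/
def cylinder (k : ℕ∞) (σ : List ℕ) : Set (Partition k) :=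
  {p | ∀ n (h : n < σ.length), p.1 n = σ[n]}

/-! ### Borel codes -/

/-- Labels of the nodes of a Borel code: `∪`, `∩`, and names of the clopen sets
`∅`, `(ω)^k`, `[σ]` and the complement of `[σ]`. -/
inductive Label : Type
  | union : Label
  | inter : Label
  | empty : Label
  | whole : Label
  | cyl (σ : List ℕ) : Label
  | compl (σ : List ℕ) : Label

/-- Labels as elements of a sum type; used only to say what computing a label means. -/
def Label.equivSum : Label ≃ (Bool ⊕ Bool) ⊕ (List ℕ ⊕ List ℕ) where
  toFun
    | .union => .inl (.inl true)
    | .inter => .inl (.inl false)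
    | .empty => .inl (.inr false)
    | .whole => .inl (.inr true)
    | .cyl σ => .inr (.inl σ)
    | .compl σ => .inr (.inr σ)
  invFun
    | .inl (.inl true) => .union
    | .inl (.inl false) => .inter
    | .inl (.inr false) => .empty
    | .inl (.inr true) => .whole
    | .inr (.inl σ) => .cyl σ
    | .inr (.inr σ) => .compl σ
  left_inv := by rintro (_ | _ | _ | _ | _ | _) <;> rfl
  right_inv := by rintro ((_ | _) | (_ | _)) <;> first | rfl | (rename_i b; cases b <;> rfl)

instance : Primcodable Label := Primcodable.ofEquiv _ Label.equivSum

/-- `Clopen k ℓ B`: the label `ℓ` names the clopen set `B ⊆ (ω)^k`. -/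
inductive Clopen (k : ℕ∞) : Label → Set (Partition k) → Prop
  | empty : Clopen k .empty ∅
  | whole : Clopen k .whole Set.univ
  | cyl (σ : List ℕ) (hσ : IsFinPartition k σ) : Clopen k (.cyl σ) (cylinder k σ)
  | compl (σ : List ℕ) (hσ : IsFinPartition k σ) : Clopen k (.compl σ) (cylinder k σ)ᶜ

/-- A labelled set of strings in `ω^{<ω}`: `T σ = none` says that `σ` is not a node, and
`T σ = some ℓ` that `σ` is a node with label `ℓ`. -/
abbrev LabelledTree : Type := List ℕ → Option Label

/-- The part of `T` above the level-one string `⟨a⟩`. -/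
def LabelledTree.subtree (T : LabelledTree) (a : ℕ) : LabelledTree := fun σ => T (a :: σ)

/-- The two kinds of classes in the Borel hierarchy. -/
inductive Kind : Type
  | sigma : Kind
  | pi : Kind

/-- `BorelCode k Γ α T A`: the labelled tree `T` is a Borel code for a (topologically) `Γ^0_α` set
in `(ω)^k` (where `Γ` is `Σ` or `Π`, and `α` is finite), and `A` is the set that `T` represents.
The subtrees at level one are those above the strings `⟨a⟩` that are nodes of `T`. -/
inductive BorelCode (k : ℕ∞) : Kind → ℕ → LabelledTree → Set (Partition k) → Prop
  | clopen (Γ : Kind) (T : LabelledTree) (ℓ : Label) (B : Set (Partition k))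
      (root : T [] = some ℓ) (clopen : Clopen k ℓ B) (leaf : ∀ σ, σ ≠ [] → T σ = none) :
      BorelCode k Γ 0 T B
  | union (α : ℕ) (pos : 1 ≤ α) (T : LabelledTree) (root : T [] = some .union)
      (tree : ∀ a, T [a] = none → ∀ σ, T (a :: σ) = none)
      (Γ : ℕ → Kind) (β : ℕ → ℕ) (A : ℕ → Set (Partition k))
      (lt : ∀ a, T [a] ≠ none → β a < α)
      (code : ∀ a, T [a] ≠ none → BorelCode k (Γ a) (β a) (T.subtree a) (A a)) :
      BorelCode k .sigma α T {p | ∃ a, T [a] ≠ none ∧ p ∈ A a}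
  | inter (α : ℕ) (pos : 1 ≤ α) (T : LabelledTree) (root : T [] = some .inter)
      (tree : ∀ a, T [a] = none → ∀ σ, T (a :: σ) = none)
      (Γ : ℕ → Kind) (β : ℕ → ℕ) (A : ℕ → Set (Partition k))
      (lt : ∀ a, T [a] ≠ none → β a < α)
      (code : ∀ a, T [a] ≠ none → BorelCode k (Γ a) (β a) (T.subtree a) (A a)) :
      BorelCode k .pi α T {p | ∀ a, T [a] ≠ none → p ∈ A a}

/-! ### Oracle machines and the Turing jump -/

/-- Programs for functions that are partial recursive relative to an oracle. The constructors are
those of the inductive definition of `Nat.RecursiveIn`. -/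
inductive Program : Type
  | zero : Program
  | succ : Program
  | left : Program
  | right : Program
  | oracle : Program
  | pair (c d : Program) : Program
  | comp (c d : Program) : Program
  | prec (c d : Program) : Program
  | rfind (c : Program) : Program

/-- The partial function that a program computes from the oracle `g`. -/
def Program.eval (g : ℕ →. ℕ) : Program → ℕ →. ℕ
  | .zero => fun _ => 0
  | .succ => Nat.succ
  | .left => fun n => (Nat.unpair n).1
  | .right => fun n => (Nat.unpair n).2
  | .oracle => g
  | .pair c d => fun n => Nat.pair <$> c.eval g n <*> d.eval g n
  | .comp c d => fun n => d.eval g n >>= c.eval g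
  | .prec c d => fun p =>
      let (a, n) := Nat.unpair p
      n.rec (c.eval g a) fun y IH => do
        let i ← IH
        d.eval g (Nat.pair a (Nat.pair y i))
  | .rfind c => fun a => Nat.rfind fun n => (fun m => m = 0) <$> c.eval g (Nat.pair a n)

/-- The Gödel number of a program; this is a bijection between programs and `ω`. -/
def Program.index : Program → ℕ
  | .zero => 0
  | .succ => 1
  | .left => 2
  | .right => 3
  | .oracle => 4
  | .pair c d => 4 * Nat.pair c.index d.index + 5
  | .comp c d => 4 * Nat.pair c.index d.index + 6
  | .prec c d => 4 * Nat.pair c.index d.index + 7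
  | .rfind c => 4 * c.index + 8

open Classical in
/-- The characteristic function of `X ⊆ ω`, as an oracle. -/
noncomputable def charFun (X : Set ℕ) : ℕ →. ℕ := fun n => Part.some (if n ∈ X then 1 else 0)

/-- The Turing jump `X' = {e : Φ_e^X(e)↓}`. -/
def jump (X : Set ℕ) : Set ℕ :=
  {e | ∃ c : Program, c.index = e ∧ (c.eval (charFun X) e).Dom}

/-- The `n`-th jump `∅^{(n)}` of the empty set. -/
def emptyJump (n : ℕ) : Set ℕ := jump^[n] ∅

/-- The partition `p` is computable from the oracle `X`. -/
def ComputableFrom {k : ℕ∞} (X : Set ℕ) (p : Partition k) : Prop :=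
  ComputableIn {charFun X} p.1

end DualRamsey

/-!
The proof is a forcing argument whose conditions are the finite strings over `{0, 1}`, read as
initial segments of elements of `(ω)^2`. A union is forced by forcing one of its members and refuted
by a condition none of whose extensions forces it; intersections are treated dually. Each level of a
Borel code costs one jump, so that forcing at level `n` is decidable in `∅^(n)`.

An infinite partition `x` is built block after block. When a new block is opened, only one of the
coarsenings of the finite part to two blocks gets its second block at this moment: the one that puts
all the old blocks into the first one. It looks like a long string of zeros, so any dense set of
conditions can be met by all coarsenings, and a further property can be imposed on them as soon as
it holds for conditions whose second block starts arbitrarily late.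

Let `R` be the union of the sets coded by the subtrees at level one. If conditions whose second
block starts arbitrarily late force membership in one of these sets, then `∅^(n+1)` builds an `x`
all of whose coarsenings meet such a condition, and these lie in `R`. Otherwise there is an `N` such
that no condition whose second block starts after `N` does so. Each subtree that is an intersection
can then be refuted densely by refuting one of its members; this is a question about the members,
which lie one level lower, so `∅^(n)` suffices to build an `x` all of whose coarsenings avoid `R`.
-/

namespace DualRamsey

open Encodable

/-! ### Computability relative to a set of oracles -/

section RelativeComputability

variable {α β γ : Type*} [Primcodable α] [Primcodable β] [Primcodable γ]
variable {O : Set (ℕ →. ℕ)}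

theorem recursiveIn_bind {f : α →. β} {g : β →. γ} (hf : RecursiveIn O f) (hg : RecursiveIn O g) :
    RecursiveIn O fun a => (f a).bind g :=
  (Nat.RecursiveIn.comp hg hf).of_eq fun n => by
    rcases decode (α := α) n with - | a
    · simp
    · simpa [Part.bind_map] using (Part.map_bind g (f a) encode).symm

theorem recursiveIn_comp {g : β →. γ} {f : α → β} (hg : RecursiveIn O g) (hf : ComputableIn O f) :
    RecursiveIn O fun a => g (f a) :=
  (recursiveIn_bind hf hg).of_eq fun _ => Part.bind_some _ _

theorem computableIn_comp {g : β → γ} {f : α → β} (hg : ComputableIn O g)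
    (hf : ComputableIn O f) : ComputableIn O fun a => g (f a) :=
  recursiveIn_comp (g := fun b => Part.some (g b)) hg hf

theorem computableIn_pair {f : α → β} {g : α → γ} (hf : ComputableIn O f)
    (hg : ComputableIn O g) : ComputableIn O fun a => (f a, g a) :=
  (Nat.RecursiveIn.pair hf hg).of_eq fun n => by
    cases decode (α := α) n <;> simp [Seq.seq]

theorem recursiveIn_natRec {f : α → ℕ} {g : α →. β} {h : α × (ℕ × β) →. β}
    (hf : ComputableIn O f) (hg : RecursiveIn O g) (hh : RecursiveIn O h) :
    RecursiveIn O fun a => (f a).rec (g a) fun y IH => IH.bind fun b => h (a, (y, b)) :=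
  (Nat.RecursiveIn.comp (Nat.RecursiveIn.prec hg hh)
    (Nat.RecursiveIn.pair Nat.Partrec.some.recursiveIn hf)).of_eq fun n => by
    rcases e : decode (α := α) n with - | a
    · simp [Seq.seq]
    · simp only [Seq.seq, Part.coe_some, Part.bind_some, Part.map_some, Part.map_eq_map, e,
        Nat.unpair_pair, Part.bind_eq_bind]
      induction f a <;> simp_all

theorem computableIn_natRec {f : α → ℕ} {g : α → β} {h : α × (ℕ × β) → β}
    (hf : ComputableIn O f) (hg : ComputableIn O g) (hh : ComputableIn O h) :
    ComputableIn O fun a => ((f a).rec (g a) fun y b => h (a, (y, b)) : β) :=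
  (recursiveIn_natRec hf hg hh).of_eq fun a => by
    beta_reduce
    induction f a with
    | zero => rfl
    | succ n ih => simp only [ih, Part.bind_some]

theorem recursiveIn_rfind {p : α × ℕ → Bool} (hp : ComputableIn O p) :
    RecursiveIn O fun a => Nat.rfind fun n => Part.some (p (a, n)) :=
  (Nat.RecursiveIn.rfind
    (computableIn_comp (Primrec.dom_bool fun b => cond b 0 1).computableIn hp)).of_eq fun n => by
    rcases e : decode (α := α) n with - | a
    · simpa [e] using Nat.rfind_zero_none _ rfl
    · simp only [e, decode_prod_val, Nat.unpair_pair, Option.map_some, Option.bind_some, decode_nat,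
        Part.coe_some, Part.bind_some, encode_nat, Part.map_some]
      congr 1
      funext n
      cases p (a, n) <;> simp

/-- The predicate `P` is decidable with the help of the oracles in `O`. -/
def ComputablePredIn (O : Set (ℕ →. ℕ)) (P : α → Prop) : Prop :=
  ∃ f : α → Bool, ComputableIn O f ∧ ∀ a, f a = true ↔ P a

namespace ComputablePredIn

variable {P Q : α → Prop}

theorem of_iff (hP : ComputablePredIn O P) (h : ∀ a, P a ↔ Q a) : ComputablePredIn O Q :=
  hP.imp fun _ hf => ⟨hf.1, fun a => (hf.2 a).trans (h a)⟩

theorem comp {P : β → Prop} (hP : ComputablePredIn O P) {f : α → β} (hf : ComputableIn O f) :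
    ComputablePredIn O fun a => P (f a) := by
  obtain ⟨g, hg, hgP⟩ := hP
  exact ⟨_, computableIn_comp hg hf, fun a => hgP (f a)⟩

theorem of_primrecPred (hP : PrimrecPred P) : ComputablePredIn O P := by
  obtain ⟨_, h⟩ := hP
  exact ⟨_, h.computableIn, fun a => decide_eq_true_iff⟩

protected theorem not (hP : ComputablePredIn O P) : ComputablePredIn O fun a => ¬ P a := by
  obtain ⟨f, hf, hfP⟩ := hP
  exact ⟨_, computableIn_comp Primrec.not.computableIn hf, fun a => by simp [← hfP a]⟩

protected theorem and (hP : ComputablePredIn O P) (hQ : ComputablePredIn O Q) :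
    ComputablePredIn O fun a => P a ∧ Q a := by
  obtain ⟨f, hf, hfP⟩ := hP
  obtain ⟨g, hg, hgQ⟩ := hQ
  exact ⟨_, computableIn_comp Primrec.and.computableIn₂ (computableIn_pair hf hg),
    fun a => by simp [← hfP a, ← hgQ a]⟩

protected theorem or (hP : ComputablePredIn O P) (hQ : ComputablePredIn O Q) :
    ComputablePredIn O fun a => P a ∨ Q a :=
  (hP.not.and hQ.not).not.of_iff fun a => by tauto

protected theorem imp (hP : ComputablePredIn O P) (hQ : ComputablePredIn O Q) :
    ComputablePredIn O fun a => P a → Q a :=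
  (hP.not.or hQ).of_iff fun a => by tauto

theorem forall_lt {P : α × ℕ → Prop} (hP : ComputablePredIn O P) {b : α → ℕ}
    (hb : ComputableIn O b) : ComputablePredIn O fun a => ∀ i < b a, P (a, i) := by
  obtain ⟨f, hf, hfP⟩ := hP
  refine ⟨fun a => (b a).rec true fun i r => r && f (a, i),
    computableIn_natRec (h := fun x => x.2.2 && f (x.1, x.2.1)) hb (.const true) ?_, fun a => ?_⟩
  · exact computableIn_comp Primrec.and.computableIn₂ (computableIn_pair
      (Primrec.snd.comp Primrec.snd).computableIn
      (computableIn_comp hf (Primrec.fst.pair (Primrec.fst.comp Primrec.snd)).computableIn))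
  · beta_reduce
    induction b a with
    | zero => simp
    | succ n ih => simp only [Nat.forall_lt_succ_right, Bool.and_eq_true, ih, hfP]

theorem exists_lt {P : α × ℕ → Prop} (hP : ComputablePredIn O P) {b : α → ℕ}
    (hb : ComputableIn O b) : ComputablePredIn O fun a => ∃ i < b a, P (a, i) :=
  (hP.not.forall_lt hb).not.of_iff fun a => by push Not; rfl

theorem exists_recursiveIn_uniformization {P : α × β → Prop} (hP : ComputablePredIn O P) :
    ∃ f : α →. β, RecursiveIn O f ∧ (∀ a, ∀ b ∈ f a, P (a, b)) ∧
      ∀ a, (∃ b, P (a, b)) → (f a).Dom := by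
  rcases isEmpty_or_nonempty β with _ | ⟨⟨b₀⟩⟩
  · exact ⟨fun _ => Part.none, .none, fun _ b => isEmptyElim b, fun _ ⟨b, _⟩ => isEmptyElim b⟩
  let d : ℕ → β := fun n => (decode n).getD b₀
  have hd : Primrec d := Primrec.option_getD.comp Primrec.decode (Primrec.const b₀)
  obtain ⟨p, hp, hpP⟩ := hP.comp (Primrec.fst.pair (hd.comp Primrec.snd)).computableIn
  refine ⟨fun a => (Nat.rfind fun n => Part.some (p (a, n))).bind fun n => Part.some (d n),
    recursiveIn_bind (recursiveIn_rfind hp) hd.computableIn, fun a b hb => ?_, fun a ⟨b, hb⟩ => ?_⟩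
  · obtain ⟨n, hn, hbn⟩ := Part.mem_bind_iff.1 hb
    rw [Part.mem_some_iff.1 hbn]
    exact (hpP (a, n)).1 (Part.mem_some_iff.1 (Nat.rfind_spec hn)).symm
  · have hpb : p (a, encode b) = true := (hpP _).2 (by simpa [d] using hb)
    exact ⟨Nat.rfind_dom.2 ⟨encode b, by simp [hpb], fun _ => trivial⟩, trivial⟩

end ComputablePredIn

theorem exists_computableIn_seq {Q : (ℕ × α) × α → Prop} (hQ : ComputablePredIn O Q)
    {I : ℕ → α → Prop} {a₀ : α} (h₀ : I 0 a₀) (hex : ∀ k a, I k a → ∃ b, Q ((k, a), b))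
    (hpres : ∀ k a b, I k a → Q ((k, a), b) → I (k + 1) b) :
    ∃ f : ℕ → α, ComputableIn O f ∧ ∀ k, I k (f k) ∧ Q ((k, f k), f (k + 1)) := by
  obtain ⟨g, hg, hgQ, hdom⟩ := hQ.exists_recursiveIn_uniformization
  have hnext : ∀ k a, I k a → ∃ b, b ∈ g (k, a) := fun k a ha =>
    Part.dom_iff_mem.1 (hdom _ (hex k a ha))
  have : Nonempty α := ⟨a₀⟩
  choose! next hnext using hnext
  let f : ℕ → α := fun k => k.rec a₀ next
  have hI : ∀ k, I k (f k) := fun k => by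
    induction k with
    | zero => exact h₀
    | succ k ih => exact hpres k _ _ ih (hgQ _ _ (hnext k _ ih))
  refine ⟨f, ?_, fun k => ⟨hI k, hgQ _ _ (hnext k _ (hI k))⟩⟩
  refine (recursiveIn_natRec (h := fun x : ℕ × (ℕ × α) => g x.2) ComputableIn.id
    (ComputableIn.const a₀) (recursiveIn_comp hg ComputableIn.snd)).of_eq_tot fun k => ?_
  induction k with
  | zero => exact Part.mem_some _
  | succ k ih => exact Part.mem_bind_iff.2 ⟨_, ih, hnext k _ (hI k)⟩

end RelativeComputability

/-! ### The Turing jump -/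

section TuringJump

namespace Program

theorem exists_eval_eq {g f : ℕ →. ℕ} (hf : Nat.RecursiveIn {g} f) :
    ∃ c : Program, c.eval g = f := by
  induction hf with
  | zero => exact ⟨.zero, rfl⟩
  | succ => exact ⟨.succ, rfl⟩
  | left => exact ⟨.left, rfl⟩
  | right => exact ⟨.right, rfl⟩
  | oracle _ h => exact ⟨.oracle, h.symm⟩
  | pair _ _ ih₁ ih₂ => obtain ⟨⟨c, rfl⟩, d, rfl⟩ := And.intro ih₁ ih₂; exact ⟨.pair c d, rfl⟩
  | comp _ _ ih₁ ih₂ => obtain ⟨⟨c, rfl⟩, d, rfl⟩ := And.intro ih₁ ih₂; exact ⟨.comp c d, rfl⟩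
  | prec _ _ ih₁ ih₂ => obtain ⟨⟨c, rfl⟩, d, rfl⟩ := And.intro ih₁ ih₂; exact ⟨.prec c d, rfl⟩
  | rfind _ ih => obtain ⟨c, rfl⟩ := ih; exact ⟨.rfind c, rfl⟩

theorem index_injective : Function.Injective index := by
  intro c
  induction c with
  | pair c₁ c₂ ih₁ ih₂ | comp c₁ c₂ ih₁ ih₂ | prec c₁ c₂ ih₁ ih₂ =>
    intro d h
    cases d with
    | pair d₁ d₂ | comp d₁ d₂ | prec d₁ d₂ =>
      simp only [index] at h
      first
        | omega
        | obtain ⟨h₁, h₂⟩ := Nat.pair_eq_pair.1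
            (show Nat.pair c₁.index c₂.index = Nat.pair d₁.index d₂.index by omega)
          rw [ih₁ h₁, ih₂ h₂]
    | _ => simp only [index] at h; omega
  | rfind c ih =>
    intro d h
    cases d with
    | rfind d => simp only [index] at h; rw [ih (show c.index = d.index by omega)]
    | _ => simp only [index] at h; omega
  | _ => intro d h; cases d <;> simp only [index] at h <;> first | rfl | omega

/-- The program with constant value `n`; composing with it hard-wires an input into a program. -/
def const : ℕ → Program
  | 0 => .zero
  | n + 1 => .comp .succ (const n)

theorem eval_const (g : ℕ →. ℕ) (n m : ℕ) : (const n).eval g m = Part.some n := by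
  induction n with
  | zero => rfl
  | succ n ih => simp only [const, eval, ih]; exact Part.bind_some _ _

theorem eval_comp_const (g : ℕ →. ℕ) (c : Program) (n m : ℕ) :
    (comp c (const n)).eval g m = c.eval g n := by
  simp only [eval, eval_const]
  exact Part.bind_some _ _

theorem primrec_index_comp (c : Program) {f : ℕ → Program} (hf : Primrec fun n => (f n).index) :
    Primrec fun n => (comp c (f n)).index :=
  Primrec.nat_add.comp (Primrec.nat_mul.comp (Primrec.const 4)
    (Primrec₂.natPair.comp (Primrec.const c.index) hf)) (Primrec.const 6)

theorem primrec_index_const : Primrec fun n => (const n).index := by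
  have h : Primrec fun n : ℕ => (n.rec 0 fun _ r => 4 * Nat.pair 1 r + 6 : ℕ) :=
    Primrec.nat_rec₁ (f := fun _ r => 4 * Nat.pair 1 r + 6) 0
      (Primrec.nat_add.comp (Primrec.nat_mul.comp (Primrec.const 4)
        (Primrec₂.natPair.comp (Primrec.const 1) Primrec.snd)) (Primrec.const 6))
  refine h.of_eq fun n => ?_
  induction n with
  | zero => rfl
  | succ n ih => simp only [ih, const, index]

end Program

theorem index_mem_jump {X : Set ℕ} {c : Program} :
    c.index ∈ jump X ↔ (c.eval (charFun X) c.index).Dom := by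
  refine ⟨?_, fun h => ⟨c, rfl, h⟩⟩
  rintro ⟨d, hd, h⟩
  rwa [Program.index_injective hd] at h

theorem computablePredIn_mem (X : Set ℕ) : ComputablePredIn {charFun X} (· ∈ X) := by
  classical
  have hX : ComputableIn {charFun X} fun n => if n ∈ X then 1 else 0 :=
    (RecursiveIn.oracle (charFun X) (Set.mem_singleton _)).of_eq fun n => by
      unfold charFun; congr
  have hone : PrimrecPred fun n : ℕ => n = 1 := Primrec.eq.comp Primrec.id (Primrec.const 1)
  exact ((ComputablePredIn.of_primrecPred hone).comp hX).of_iff fun n => by simp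

namespace ComputablePredIn

variable {α β : Type*} [Primcodable α] [Primcodable β] {X : Set ℕ}

theorem exists_jump {P : α × β → Prop} (hP : ComputablePredIn {charFun X} P) :
    ComputablePredIn {charFun (jump X)} fun a => ∃ b, P (a, b) := by
  obtain ⟨f, hf, hfP, hdom⟩ := hP.exists_recursiveIn_uniformization
  obtain ⟨c, hc⟩ := Program.exists_eval_eq hf
  have hindex : Primrec fun a : α => (Program.comp c (.const (encode a))).index :=
    (Program.primrec_index_comp c Program.primrec_index_const).comp Primrec.encode
  refine ((computablePredIn_mem (jump X)).comp hindex.computableIn).of_iff fun a => ?_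
  rw [index_mem_jump, Program.eval_comp_const, hc]
  simp only [encodek, Part.coe_some, Part.bind_some, Part.map_Dom]
  exact ⟨fun h => ⟨(f a).get h, hfP a _ (Part.get_mem h)⟩, hdom a⟩

protected theorem jump {P : α → Prop} (hP : ComputablePredIn {charFun X} P) :
    ComputablePredIn {charFun (jump X)} P :=
  (exists_jump (β := ℕ) (P := fun x => P x.1) (hP.comp ComputableIn.fst)).of_iff
    fun a => by simp only [exists_const]

end ComputablePredIn

theorem emptyJump_succ (n : ℕ) : emptyJump (n + 1) = jump (emptyJump n) :=
  Function.iterate_succ_apply' _ _ _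

end TuringJump

/-! ### Density conditions on strings -/

section Strings

variable {α : Type*} {G P Q : List α → Prop}

/-- A set of strings that contains every extension of its elements. -/
def ExtensionClosed (P : List α → Prop) : Prop :=
  ∀ ⦃σ τ⦄, σ <+: τ → P σ → P τ

/-- Every string in `G` has an extension in `G ∩ Q`: the set `Q` is dense in the forcing notion of
the strings in `G`, ordered by extension. -/
def DenseIn (G Q : List α → Prop) : Prop :=
  ∀ σ, G σ → ∃ τ, σ <+: τ ∧ G τ ∧ Q τ

theorem ExtensionClosed.and (hP : ExtensionClosed P) (hQ : ExtensionClosed Q) :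
    ExtensionClosed fun σ => P σ ∧ Q σ :=
  fun _ _ h => And.imp (hP h) (hQ h)

theorem DenseIn.and (hP : DenseIn G P) (hPe : ExtensionClosed P) (hQ : DenseIn G Q) :
    DenseIn G fun σ => P σ ∧ Q σ := by
  intro σ hσ
  obtain ⟨τ, hστ, hGτ, hPτ⟩ := hP σ hσ
  obtain ⟨ρ, hτρ, hGρ, hQρ⟩ := hQ τ hGτ
  exact ⟨ρ, hστ.trans hτρ, hGρ, hPe hτρ hPτ, hQρ⟩

theorem DenseIn.forall_mem_finset {ι : Type*} {Q : ι → List α → Prop} (s : Finset ι)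
    (hQ : ∀ i ∈ s, DenseIn G (Q i)) (hQe : ∀ i ∈ s, ExtensionClosed (Q i)) :
    DenseIn G fun σ => ∀ i ∈ s, Q i σ := by
  classical
  induction s using Finset.induction_on with
  | empty => exact fun σ hσ => ⟨σ, List.prefix_rfl, hσ, by simp⟩
  | insert i s _ ih =>
    simp only [Finset.forall_mem_insert] at hQ hQe ⊢
    exact hQ.1.and hQe.1 (ih hQ.2 hQe.2)

theorem ExtensionClosed.denseIn (hG : ExtensionClosed G) (hQ : ∀ σ, ∃ τ, σ <+: τ ∧ Q τ) :
    DenseIn G Q := fun σ hσ =>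
  (hQ σ).imp fun _ h => ⟨h.1, hG h.1 hσ, h.2⟩

theorem primrecRel_isPrefix [Primcodable α] : PrimrecRel fun σ τ : List α => σ <+: τ :=
  (Primrec.eq.comp Primrec.fst (Primrec.list_take.comp
    (Primrec.list_length.comp Primrec.fst) Primrec.snd)).of_eq fun _ =>
      List.prefix_iff_eq_take.symm

end Strings

/-- The string of length `l` that records which of the numbers below `l` lie in the block with
number one of `q`; strings over `Bool` are the conditions of the forcing below. -/
def initSeg (q : ℕ → ℕ) (l : ℕ) : List Bool :=
  (List.range l).map fun i => decide (q i = 1)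

theorem initSeg_prefix_initSeg (q : ℕ → ℕ) {l m : ℕ} (h : l ≤ m) :
    initSeg q l <+: initSeg q m := by
  obtain ⟨d, rfl⟩ := Nat.exists_eq_add_of_le h
  rw [initSeg, initSeg, List.range_add, List.map_append]
  exact List.prefix_append _ _

/-- The condition `σ` puts `0, …, N - 1` into the first block and some number into the second. -/
def LateSecondBlock (N : ℕ) (σ : List Bool) : Prop :=
  List.replicate N false <+: σ ∧ true ∈ σ

theorem lateSecondBlock_replicate_append (N : ℕ) :
    LateSecondBlock N (List.replicate N false ++ [true]) :=
  ⟨List.prefix_append _ _, by simp⟩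

theorem LateSecondBlock.of_le {M N : ℕ} {σ : List Bool} (h : LateSecondBlock N σ) (hMN : M ≤ N) :
    LateSecondBlock M σ :=
  ⟨(List.prefix_replicate_iff.2 (by simpa using hMN)).trans h.1, h.2⟩

theorem extensionClosed_lateSecondBlock (N : ℕ) : ExtensionClosed (LateSecondBlock N) :=
  fun _ _ h => And.imp (fun hN => hN.trans h) fun ht => h.subset ht

theorem primrecPred_lateSecondBlock (N : ℕ) : PrimrecPred (LateSecondBlock N) :=
  (primrecRel_isPrefix.comp (Primrec.const _) Primrec.id).and
    (((PrimrecRel.exists_mem_list Primrec.eq).comp Primrec.id (Primrec.const true)).of_eq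
      fun _ => by simp)

/-! ### Generic infinite partitions -/

section Colorings

/-- `c` describes a coarsening to two blocks of a partition into `k` blocks, by naming the blocks
that make up the second one. -/
def IsColoring (k : ℕ) (c : ℕ → Bool) : Prop :=
  c 0 = false ∧ ∃ j < k, c j = true

theorem IsColoring.mono {k l : ℕ} {c : ℕ → Bool} (hc : IsColoring k c) (h : k ≤ l) :
    IsColoring l c :=
  ⟨hc.1, hc.2.imp fun _ hj => ⟨hj.1.trans_le h, hj.2⟩⟩

theorem isColoring_congr {k : ℕ} {c d : ℕ → Bool} (hk : 0 < k) (h : ∀ j < k, c j = d j) :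
    IsColoring k c ↔ IsColoring k d := by
  rw [IsColoring, IsColoring, h 0 hk]
  exact and_congr_right fun _ => exists_congr fun j => and_congr_right fun hj => by rw [h j hj]

theorem forall_isColoring_iff_testBit {k : ℕ} (hk : 0 < k) {w : List ℕ} (hw : ∀ a ∈ w, a < k)
    (P : List Bool → Prop) :
    (∀ c, IsColoring k c → P (w.map c)) ↔
      ∀ m < 2 ^ k, IsColoring k m.testBit → P (w.map m.testBit) := by
  refine ⟨fun h m _ => h _, fun h c hc => ?_⟩
  have hbit : ∀ j < k, (Nat.ofBits fun i : Fin k => c i).testBit j = c j := fun j hj =>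
    Nat.testBit_ofBits_lt _ _ hj
  have := h _ (Nat.ofBits_lt_two_pow _) ((isColoring_congr hk hbit).2 hc)
  rwa [List.map_congr_left fun a ha => hbit a (hw a ha)] at this

/-- The string over `{0, j}` that the colourings with `0 ↦ false` and `j ↦ true` turn into `τ`. -/
def paint (j : ℕ) (τ : List Bool) : List ℕ :=
  τ.map fun b => bif b then j else 0

theorem map_paint {j : ℕ} {c : ℕ → Bool} (h₀ : c 0 = false) (hj : c j = true) (τ : List Bool) :
    (paint j τ).map c = τ := by
  rw [paint, List.map_map]
  exact List.map_id'' (fun b => by cases b <;> simpa) τ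

theorem le_of_mem_paint {j a : ℕ} {τ : List Bool} (h : a ∈ paint j τ) : a ≤ j := by
  obtain ⟨b, -, rfl⟩ := List.mem_map.1 h
  cases b <;> simp

theorem mem_paint {j : ℕ} {τ : List Bool} (h : true ∈ τ) : j ∈ paint j τ :=
  List.mem_map.2 ⟨true, h, rfl⟩

theorem primrec_two_pow : Primrec fun n : ℕ => 2 ^ n :=
  (Primrec₂.unpaired'.1 Nat.Primrec.pow).comp (Primrec.const 2) Primrec.id

theorem primrec_testBit : Primrec₂ Nat.testBit := by
  have hodd : PrimrecPred fun x : ℕ × ℕ => x.1 / 2 ^ x.2 % 2 = 1 :=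
    Primrec.eq.comp (Primrec.nat_mod.comp
      (Primrec.nat_div.comp Primrec.fst (primrec_two_pow.comp Primrec.snd))
      (Primrec.const 2))
      (Primrec.const 1)
  exact hodd.decide.of_eq fun _ => Nat.testBit_eq_decide_div_mod_eq.symm

end Colorings

section FinitePartitions

theorem IsFinPartition.lt_length {k : ℕ} {u : List ℕ} (hu : IsFinPartition (k + 1 : ℕ) u) :
    k < u.length := by
  have hsub : List.range (k + 1) ⊆ u := fun i hi =>
    hu.2.2 i (by exact_mod_cast List.mem_range.1 hi)
  simpa using (List.nodup_range.subperm hsub).length_le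

theorem IsFinPartition.succ_of_isPrefix {k : ℕ} {u w : List ℕ} (hu : IsFinPartition k u)
    (huw : u <+: w) (hw : ∀ a ∈ w, a < k + 1) (hk : k ∈ w) : IsFinPartition (k + 1 : ℕ) w := by
  have hmem : ∀ i < k, i ∈ u := fun i hi => hu.2.2 i (by exact_mod_cast hi)
  refine ⟨fun a ha => by exact_mod_cast hw a ha, fun n hn j hj => ?_, fun i hi => ?_⟩
  · rcases lt_or_ge n u.length with hnu | hun
    · rw [← huw.getElem hnu] at hj
      exact (huw.take n).subset (hu.2.1 n hnu j hj)
    · have := hw _ (List.getElem_mem hn)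
      exact ((List.prefix_take_iff).2 ⟨huw, hun⟩).subset (hmem j (by omega))
  · rcases (Nat.lt_succ_iff.1 (by exact_mod_cast hi : i < k + 1)).lt_or_eq with hi | rfl
    · exact huw.subset (hmem i hi)
    · exact hk

end FinitePartitions

section Construction

/-- The string `u` partitions an initial segment of `ω` into `k + 1` blocks, and all its coarsenings
to two blocks satisfy `M`. -/
def IsStage (M : List Bool → Prop) (k : ℕ) (u : List ℕ) : Prop :=
  IsFinPartition (k + 1 : ℕ) u ∧ ∀ c, IsColoring (k + 1) c → M (u.map c)

/-- The string `w` adds one block to the stage `u` with `k + 1` blocks, such that all coarsenings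
of `w` to two blocks satisfy `M` and the first `k + 2` of the requirements `D`. -/
def IsStep (M : List Bool → Prop) (D : ℕ → List Bool → Prop) (k : ℕ) (u w : List ℕ) : Prop :=
  u <+: w ∧ k + 1 ∈ w ∧ (∀ a ∈ w, a < k + 2) ∧
    ∀ c, IsColoring (k + 2) c → M (w.map c) ∧ ∀ s < k + 2, D s (w.map c)

variable {M : List Bool → Prop} {D : ℕ → List Bool → Prop} {k : ℕ} {u w : List ℕ}

theorem IsStage.succ (hu : IsStage M k u) (hw : IsStep M D k u w) : IsStage M (k + 1) w :=
  ⟨hu.1.succ_of_isPrefix hw.1 hw.2.2.1 hw.2.1, fun c hc => (hw.2.2.2 c hc).1⟩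

theorem isStage_zero (M : List Bool → Prop) : IsStage M 0 [0] := by
  refine ⟨⟨by simp, fun n hn j hj => ?_, fun i hi => ?_⟩, ?_⟩
  · simp at hj
  · simpa using hi
  · rintro c ⟨h₀, j, hj, hcj⟩
    obtain rfl : j = 0 := by omega
    simp_all

theorem IsStage.exists_new_block (hM : ExtensionClosed M)
    (hlate : ∀ N, ∃ σ, LateSecondBlock N σ ∧ M σ) (hu : IsStage M k u) :
    ∃ w, u <+: w ∧ k + 1 ∈ w ∧ (∀ a ∈ w, a < k + 2) ∧ ∀ c, IsColoring (k + 2) c → M (w.map c) := by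
  obtain ⟨_, ⟨⟨ρ, rfl⟩, htrue⟩, hMρ⟩ := hlate u.length
  have hρ : true ∈ ρ := by simpa using htrue
  have hu_lt : ∀ a ∈ u, a < k + 1 := fun a ha => by exact_mod_cast hu.1.1 a ha
  refine ⟨u ++ paint (k + 1) ρ, List.prefix_append _ _, ?_, fun a ha => ?_, fun c hc => ?_⟩
  · exact List.mem_append_right _ (mem_paint hρ)
  · rcases List.mem_append.1 ha with ha | ha
    · have := hu_lt a ha
      omega
    · have := le_of_mem_paint ha
      omega
  rw [List.map_append]
  by_cases hold : IsColoring (k + 1) c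
  · exact hM (List.prefix_append _ _) (hu.2 c hold)
  · have hfalse : ∀ a < k + 1, c a = false := fun a ha =>
      Bool.eq_false_iff.2 fun h => hold ⟨hc.1, a, ha, h⟩
    obtain ⟨j, hj, hcj⟩ := hc.2
    obtain rfl : j = k + 1 := by
      by_contra hne
      simp [hfalse j (by omega)] at hcj
    rwa [map_paint hc.1 hcj, List.map_congr_left fun a ha => hfalse a (hu_lt a ha),
      List.map_const']

theorem exists_map_meets {K : ℕ} (hK : 0 < K) (hM : ExtensionClosed M)
    (hD : ∀ s, ExtensionClosed (D s)) (hdense : ∀ s, DenseIn M (D s)) (n : ℕ)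
    (hw : ∀ a ∈ w, a < K) (hwM : ∀ c, IsColoring K c → M (w.map c)) :
    ∃ v, w <+: v ∧ (∀ a ∈ v, a < K) ∧
      ∀ c, IsColoring K c → M (v.map c) ∧ ∀ s < n, D s (v.map c) := by
  let G : List ℕ → Prop := fun v => (∀ a ∈ v, a < K) ∧ ∀ c, IsColoring K c → M (v.map c)
  let Q : ℕ × ℕ → List ℕ → Prop := fun i v => IsColoring K i.1.testBit → D i.2 (v.map i.1.testBit)
  have hQe : ∀ i, ExtensionClosed (Q i) := fun i v v' h hv hc => hD i.2 (h.map _) (hv hc)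
  have hQ : ∀ i, DenseIn G (Q i) := by
    rintro ⟨m, s⟩ v hv
    by_cases hc : IsColoring K m.testBit
    · obtain ⟨j, hj, hcj⟩ := hc.2
      obtain ⟨_, ⟨ρ, rfl⟩, -, hDρ⟩ := hdense s _ (hv.2 _ hc)
      refine ⟨v ++ paint j ρ, List.prefix_append _ _, ⟨fun a ha => ?_, fun d hd => ?_⟩, fun _ => ?_⟩
      · exact (List.mem_append.1 ha).elim (hv.1 a) fun ha => (le_of_mem_paint ha).trans_lt hj
      · exact hM ((List.prefix_append _ _).map d) (hv.2 d hd)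
      · rwa [List.map_append, map_paint hc.1 hcj]
    · exact ⟨v, List.prefix_rfl, hv, fun h => absurd h hc⟩
  obtain ⟨v, hwv, hGv, hQv⟩ := DenseIn.forall_mem_finset (Finset.range (2 ^ K) ×ˢ Finset.range n)
    (fun i _ => hQ i) (fun i _ => hQe i) w ⟨hw, hwM⟩
  refine ⟨v, hwv, hGv.1, fun c hc => ⟨hGv.2 c hc, fun s hs => ?_⟩⟩
  refine (forall_isColoring_iff_testBit hK hGv.1 (D s)).2 (fun m hm hmc => ?_) c hc
  exact hQv (m, s) (Finset.mk_mem_product (Finset.mem_range.2 hm) (Finset.mem_range.2 hs)) hmc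

theorem IsStage.exists_isStep (hM : ExtensionClosed M) (hD : ∀ s, ExtensionClosed (D s))
    (hdense : ∀ s, DenseIn M (D s)) (hlate : ∀ N, ∃ σ, LateSecondBlock N σ ∧ M σ)
    (hu : IsStage M k u) : ∃ w, IsStep M D k u w := by
  obtain ⟨v, huv, hkv, hv, hvM⟩ := hu.exists_new_block hM hlate
  obtain ⟨w, hvw, hw, hwD⟩ := exists_map_meets (by omega) hM hD hdense (k + 2) hv hvM
  exact ⟨w, huv.trans hvw, hvw.subset hkv, hw, hwD⟩

variable {O : Set (ℕ →. ℕ)}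

theorem computablePredIn_forall_testBit {P : ℕ × List Bool → Prop} (hP : ComputablePredIn O P) :
    ComputablePredIn O fun x : ℕ × List ℕ =>
      ∀ m < 2 ^ x.1, IsColoring x.1 m.testBit → P (x.1, x.2.map m.testBit) := by
  have hbit : PrimrecPred fun x : ((ℕ × List ℕ) × ℕ) × ℕ => x.1.2.testBit x.2 = true :=
    Primrec.eq.comp (primrec_testBit.comp (Primrec.snd.comp Primrec.fst) Primrec.snd)
      (Primrec.const true)
  have hbit₀ : PrimrecPred fun x : (ℕ × List ℕ) × ℕ => x.2.testBit 0 = false :=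
    Primrec.eq.comp (primrec_testBit.comp Primrec.snd (Primrec.const 0)) (Primrec.const false)
  have hcoloring : ComputablePredIn O fun x : (ℕ × List ℕ) × ℕ => IsColoring x.1.1 x.2.testBit :=
    (ComputablePredIn.of_primrecPred hbit₀).and
      ((ComputablePredIn.of_primrecPred hbit).exists_lt
        (Primrec.fst.comp Primrec.fst).computableIn)
  have hmap : Primrec fun x : (ℕ × List ℕ) × ℕ => (x.1.1, x.1.2.map x.2.testBit) :=
    (Primrec.fst.comp Primrec.fst).pair (Primrec.list_map (Primrec.snd.comp Primrec.fst)
      (primrec_testBit.comp (Primrec.snd.comp Primrec.fst) Primrec.snd))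
  exact (hcoloring.imp (hP.comp hmap.computableIn)).forall_lt
    (primrec_two_pow.comp Primrec.fst).computableIn

theorem computablePredIn_isStep (hM : ComputablePredIn O M)
    (hD : ComputablePredIn O fun x : ℕ × List Bool => D x.1 x.2) :
    ComputablePredIn O fun x : (ℕ × List ℕ) × List ℕ => IsStep M D x.1.1 x.1.2 x.2 := by
  have hpre : PrimrecPred fun x : (ℕ × List ℕ) × List ℕ => x.1.2 <+: x.2 :=
    primrecRel_isPrefix.comp (Primrec.snd.comp Primrec.fst) Primrec.snd
  have hadd (i : ℕ) : Primrec fun x : (ℕ × List ℕ) × List ℕ => x.1.1 + i :=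
    Primrec.nat_add.comp (Primrec.fst.comp Primrec.fst) (Primrec.const i)
  have hmem : PrimrecPred fun x : (ℕ × List ℕ) × List ℕ => ∃ a ∈ x.2, a = x.1.1 + 1 :=
    (PrimrecRel.exists_mem_list Primrec.eq).comp Primrec.snd (hadd 1)
  have hlt : PrimrecPred fun x : (ℕ × List ℕ) × List ℕ => ∀ a ∈ x.2, a < x.1.1 + 2 :=
    (PrimrecRel.forall_mem_list Primrec.nat_lt).comp Primrec.snd (hadd 2)
  have hmeets : ComputablePredIn O fun x : ℕ × List Bool => M x.2 ∧ ∀ s < x.1, D s x.2 :=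
    (hM.comp ComputableIn.snd).and
      ((hD.comp (Primrec.snd.pair (Primrec.snd.comp Primrec.fst)).computableIn).forall_lt
        ComputableIn.fst)
  refine ((ComputablePredIn.of_primrecPred hpre).and <|
    (ComputablePredIn.of_primrecPred hmem).and <| (ComputablePredIn.of_primrecPred hlt).and <|
    (computablePredIn_forall_testBit hmeets).comp ((hadd 2).pair Primrec.snd).computableIn).of_iff
      fun x => ?_
  simp only [IsStep, exists_eq_right]
  refine and_congr_right fun _ => and_congr_right fun _ => and_congr_right fun hw => ?_
  exact (forall_isColoring_iff_testBit (by omega) hw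
    fun σ => M σ ∧ ∀ s < x.1.1 + 2, D s σ).symm

end Construction

section Limit

/-- The limit of an increasing sequence of strings; its `i`-th entry is the `i`-th entry of the
`i`-th string, which for the sequences considered here has length greater than `i`. -/
def limitSeq (U : ℕ → List ℕ) (i : ℕ) : ℕ :=
  (U i).getD i 0

theorem computableIn_limitSeq {O : Set (ℕ →. ℕ)} {U : ℕ → List ℕ} (hU : ComputableIn O U) :
    ComputableIn O (limitSeq U) :=
  computableIn_comp (g := fun x : List ℕ × ℕ => x.1.getD x.2 0)
    (Primrec.list_getD 0).computableIn₂ (computableIn_pair hU ComputableIn.id)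

variable {U : ℕ → List ℕ} (hU : ∀ k, U k <+: U (k + 1)) (hlen : ∀ k, k < (U k).length)
include hU hlen

theorem limitSeq_eq_getElem {k i : ℕ} (hi : i < (U k).length) : limitSeq U i = (U k)[i] := by
  have hmono {j l : ℕ} (h : j ≤ l) : U j <+: U l := by
    induction l, h using Nat.le_induction with
    | base => exact List.prefix_rfl
    | succ l _ ih => exact ih.trans (hU l)
  rw [limitSeq, List.getD_eq_getElem _ _ (hlen i)]
  rcases le_total i k with h | h
  · exact (hmono h).getElem _
  · exact ((hmono h).getElem _).symm

theorem isPartition_limitSeq (hfin : ∀ k, IsFinPartition (k + 1 : ℕ) (U k)) :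
    IsPartition ⊤ (limitSeq U) := by
  refine ⟨fun n => ENat.natCast_lt_top _, fun n j hj => ?_, fun i _ => ?_⟩
  · rw [limitSeq_eq_getElem hU hlen (hlen n)] at hj
    obtain ⟨m, hm, rfl⟩ := List.mem_take_iff_getElem.1 ((hfin n).2.1 n (hlen n) j hj)
    exact ⟨m, by omega, limitSeq_eq_getElem hU hlen _⟩
  · obtain ⟨n, hn, h⟩ := List.getElem_of_mem ((hfin i).2.2 i (by exact_mod_cast i.lt_succ_self))
    exact ⟨n, (limitSeq_eq_getElem hU hlen hn).trans h⟩

theorem initSeg_eq_map {q : ℕ → ℕ} {c : ℕ → Bool} (hc : ∀ n, c (limitSeq U n) = decide (q n = 1))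
    (k : ℕ) : initSeg q (U k).length = (U k).map c := by
  refine List.ext_getElem (by simp [initSeg]) fun i _ hi => ?_
  rw [List.length_map] at hi
  simp [initSeg, ← hc, limitSeq_eq_getElem hU hlen hi]

end Limit

section Coarsenings

theorem IsPartition.apply_zero {k : ℕ∞} {p : ℕ → ℕ} (hp : IsPartition k p) : p 0 = 0 := by
  by_contra h
  obtain ⟨m, hm, -⟩ := hp.2.1 0 0 (Nat.pos_of_ne_zero h)
  exact m.not_lt_zero hm

theorem exists_coloring_of_mem_coarsenings {x : Partition ⊤} {q : Partition 2}
    (hq : q ∈ coarsenings x 2) :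
    ∃ c : ℕ → Bool, (∃ k, IsColoring k c) ∧ ∀ n, c (x.1 n) = decide (q.1 n = 1) := by
  choose r hr using fun j => x.2.2.2 j (ENat.natCast_lt_top j)
  have hc (n : ℕ) : decide (q.1 (r (x.1 n)) = 1) = decide (q.1 n = 1) := by rw [hq _ n (hr _)]
  obtain ⟨m, hm⟩ := q.2.2.2 1 (by norm_num)
  refine ⟨fun j => decide (q.1 (r j) = 1), ⟨x.1 m + 1, ?_, x.1 m, Nat.lt_succ_self _, ?_⟩, hc⟩
  · simpa [x.2.apply_zero, q.2.apply_zero] using hc 0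
  · simpa [hm] using hc m

theorem exists_partition_forall_coarsenings_meet {O : Set (ℕ →. ℕ)} {M : List Bool → Prop}
    {D : ℕ → List Bool → Prop} (hM : ComputablePredIn O M)
    (hD : ComputablePredIn O fun x : ℕ × List Bool => D x.1 x.2) (hMe : ExtensionClosed M)
    (hDe : ∀ s, ExtensionClosed (D s)) (hlate : ∀ N, ∃ σ, LateSecondBlock N σ ∧ M σ)
    (hdense : ∀ s, DenseIn M (D s)) :
    ∃ x : Partition ⊤, ComputableIn O x.1 ∧ ∀ q ∈ coarsenings x 2,
      (∃ l, M (initSeg q.1 l)) ∧ ∀ s, ∃ l, D s (initSeg q.1 l) := by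
  obtain ⟨U, hUO, hU⟩ := exists_computableIn_seq (computablePredIn_isStep hM hD)
    (I := IsStage M) (isStage_zero M) (fun _ _ hu => hu.exists_isStep hMe hDe hdense hlate)
    fun _ _ _ hu hw => hu.succ hw
  have hpre : ∀ k, U k <+: U (k + 1) := fun k => (hU k).2.1
  have hlen : ∀ k, k < (U k).length := fun k => (hU k).1.1.lt_length
  refine ⟨⟨_, isPartition_limitSeq hpre hlen fun k => (hU k).1.1⟩,
    computableIn_limitSeq hUO, fun q hq => ?_⟩
  obtain ⟨c, ⟨k, hc⟩, hcq⟩ := exists_coloring_of_mem_coarsenings hq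
  have hmeet (s : ℕ) : M ((U (k + s + 1)).map c) ∧ D s ((U (k + s + 1)).map c) := by
    have := (hU (k + s)).2.2.2.2 c (hc.mono (show k ≤ k + s + 2 by omega))
    exact ⟨this.1, this.2 s (show s < k + s + 2 by omega)⟩
  simp only [← initSeg_eq_map hpre hlen hcq] at hmeet
  exact ⟨⟨_, (hmeet 0).1⟩, fun s => ⟨_, (hmeet s).2⟩⟩

end Coarsenings

/-! ### Values of Borel codes -/

section Value

variable {k : ℕ∞}

/-- The clopen set named by a label; it is `∅` where the label does not name one. -/
def clopenSet (k : ℕ∞) : Option Label → Set (Partition k)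
  | some .whole => Set.univ
  | some (.cyl ρ) => cylinder k ρ
  | some (.compl ρ) => (cylinder k ρ)ᶜ
  | _ => ∅

/-- The set that a labelled tree represents when it is evaluated down to a given level, where all
nodes are read as leaves. -/
def LabelledTree.value (k : ℕ∞) : LabelledTree → ℕ → Set (Partition k)
  | T, 0 => clopenSet k (T [])
  | T, α + 1 => match T [] with
    | some .union => {p | ∃ a, T [a] ≠ none ∧ p ∈ LabelledTree.value k (T.subtree a) α}
    | some .inter => {p | ∀ a, T [a] ≠ none → p ∈ LabelledTree.value k (T.subtree a) α}
    | ℓ => clopenSet k ℓ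

theorem LabelledTree.value_succ_of_union {T : LabelledTree} (h : T [] = some .union) (α : ℕ) :
    T.value k (α + 1) = {p | ∃ a, T [a] ≠ none ∧ p ∈ (T.subtree a).value k α} := by
  rw [LabelledTree.value, h]

theorem LabelledTree.value_succ_of_inter {T : LabelledTree} (h : T [] = some .inter) (α : ℕ) :
    T.value k (α + 1) = {p | ∀ a, T [a] ≠ none → p ∈ (T.subtree a).value k α} := by
  rw [LabelledTree.value, h]

theorem LabelledTree.value_of_leaf {T : LabelledTree} (hunion : T [] ≠ some .union)
    (hinter : T [] ≠ some .inter) (α : ℕ) : T.value k α = clopenSet k (T []) := by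
  cases α with
  | zero => rfl
  | succ α => rw [LabelledTree.value]; split <;> simp_all

theorem Clopen.eq_clopenSet {ℓ : Label} {B : Set (Partition k)} (h : Clopen k ℓ B) :
    B = clopenSet k (some ℓ) := by
  cases h <;> rfl

theorem BorelCode.eq_value {Γ : Kind} {α n : ℕ} {T : LabelledTree} {A : Set (Partition k)}
    (h : BorelCode k Γ α T A) (hn : α ≤ n) : A = T.value k n := by
  induction h generalizing n with
  | clopen _ T ℓ B root hB _ =>
    have hunion : ℓ ≠ .union := by cases hB <;> simp
    have hinter : ℓ ≠ .inter := by cases hB <;> simp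
    rw [LabelledTree.value_of_leaf (by simpa [root]) (by simpa [root]), root, hB.eq_clopenSet]
  | union α pos T root _ _ β A lt _ ih =>
    obtain ⟨n, rfl⟩ := Nat.exists_eq_add_of_le' (pos.trans hn)
    rw [LabelledTree.value_succ_of_union root]
    ext p
    refine exists_congr fun a => and_congr_right fun ha => ?_
    rw [ih a ha (n := n) (by have := lt a ha; omega)]
  | inter α pos T root _ _ β A lt _ ih =>
    obtain ⟨n, rfl⟩ := Nat.exists_eq_add_of_le' (pos.trans hn)
    rw [LabelledTree.value_succ_of_inter root]
    ext p
    refine forall_congr' fun a => imp_congr_right fun ha => ?_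
    rw [ih a ha (n := n) (by have := lt a ha; omega)]

theorem BorelCode.root_eq_union {α : ℕ} {T : LabelledTree} {A : Set (Partition k)}
    (h : BorelCode k .sigma (α + 1) T A) : T [] = some .union := by
  cases h with
  | union _ _ _ root => exact root

end Value

/-! ### Forcing membership in the set of a Borel code -/

section ForcesClopen

/-- The string that occurs in a label; it is empty in the labels without one. -/
def labelString : Option Label → List ℕ
  | some (.cyl ρ) => ρ
  | some (.compl ρ) => ρ
  | _ => []

/-- The elements of `(ω)^2` that extend `σ` lie in the clopen set named by a label; for strings
`σ` that are at least as long as the string of the label. -/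
def LabelHolds (ℓ : Option Label) (σ : List Bool) : Prop :=
  match ℓ with
  | some .whole => True
  | some (.cyl ρ) => ρ <+: σ.map Bool.toNat
  | some (.compl ρ) => ¬ ρ <+: σ.map Bool.toNat
  | _ => False

/-- The string `σ` is long enough to decide membership in the clopen set named by `ℓ`, and decides
it as `s`. -/
def ForcesClopen (ℓ : Option Label) (σ : List Bool) (s : Bool) : Prop :=
  (labelString ℓ).length ≤ σ.length ∧ (LabelHolds ℓ σ ↔ s = true)

theorem labelHolds_iff_of_isPrefix {ℓ : Option Label} {σ τ : List Bool} (h : σ <+: τ)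
    (hℓ : (labelString ℓ).length ≤ σ.length) : LabelHolds ℓ τ ↔ LabelHolds ℓ σ := by
  have hpre {ρ : List ℕ} (hρ : ρ.length ≤ σ.length) :
      ρ <+: τ.map Bool.toNat ↔ ρ <+: σ.map Bool.toNat :=
    ⟨fun hτ => List.prefix_of_prefix_length_le hτ (h.map _) (by simpa),
      fun hσ => hσ.trans (h.map _)⟩
  rcases ℓ with - | - | - | - | - | ρ | ρ
  case some.cyl => exact hpre hℓ
  case some.compl => exact not_congr (hpre hℓ)
  all_goals rfl

theorem extensionClosed_forcesClopen (ℓ : Option Label) (s : Bool) :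
    ExtensionClosed fun σ => ForcesClopen ℓ σ s :=
  fun _ _ h hσ => ⟨hσ.1.trans h.length_le, (labelHolds_iff_of_isPrefix h hσ.1).trans hσ.2⟩

theorem exists_prefix_forcesClopen (ℓ : Option Label) (σ : List Bool) :
    ∃ τ, σ <+: τ ∧ ∃ s, ForcesClopen ℓ τ s := by
  classical
  exact ⟨σ ++ List.replicate (labelString ℓ).length false, List.prefix_append _ _,
    decide (LabelHolds ℓ _), by simp, decide_eq_true_iff.symm⟩

theorem mem_cylinder_iff_prefix_initSeg {q : Partition 2} {ρ : List ℕ} {l : ℕ}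
    (hl : ρ.length ≤ l) : q ∈ cylinder 2 ρ ↔ ρ <+: (initSeg q.1 l).map Bool.toNat := by
  have hq : ∀ i, (decide (q.1 i = 1)).toNat = q.1 i := fun i => by
    have : q.1 i < 2 := by exact_mod_cast q.2.1 i
    rcases (by omega : q.1 i = 0 ∨ q.1 i = 1) with h | h <;> simp [h]
  rw [List.prefix_iff_getElem]
  simp only [initSeg, List.map_map, List.length_map, List.length_range, List.getElem_map,
    List.getElem_range, Function.comp_apply, hq, hl, exists_true_left]
  exact forall₂_congr fun _ _ => eq_comm

theorem ForcesClopen.mem_clopenSet_iff {ℓ : Option Label} {q : Partition 2} {l : ℕ} {s : Bool}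
    (h : ForcesClopen ℓ (initSeg q.1 l) s) : q ∈ clopenSet 2 ℓ ↔ s = true := by
  rw [← h.2]
  have hl := h.1
  simp only [initSeg, List.length_map, List.length_range] at hl
  rcases ℓ with - | - | - | - | - | ρ | ρ
  case some.cyl => exact mem_cylinder_iff_prefix_initSeg hl
  case some.compl => exact not_congr (mem_cylinder_iff_prefix_initSeg hl)
  all_goals simp [clopenSet, LabelHolds]

end ForcesClopen

section Forces

/-- The condition `σ` settles whether an extension-closed property `C` is met, in the sense of
Cohen forcing: it has the property, or none of its extensions does. -/
def Decides (C : List Bool → Prop) (σ : List Bool) : Bool → Prop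
  | true => C σ
  | false => ∀ τ, σ <+: τ → ¬ C τ

theorem extensionClosed_decides {C : List Bool → Prop} (hC : ExtensionClosed C) (s : Bool) :
    ExtensionClosed fun σ => Decides C σ s := by
  cases s with
  | true => exact hC
  | false => exact fun σ τ h hσ ρ hρ => hσ ρ (h.trans hρ)

theorem exists_prefix_decides (C : List Bool → Prop) (σ : List Bool) :
    ∃ τ, σ <+: τ ∧ ∃ s, Decides C τ s := by
  by_cases h : ∃ τ, σ <+: τ ∧ C τ
  · obtain ⟨τ, hστ, hτ⟩ := h
    exact ⟨τ, hστ, true, hτ⟩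
  · exact ⟨σ, List.prefix_rfl, false, fun τ hστ hτ => h ⟨τ, hστ, hτ⟩⟩

namespace LabelledTree

/-- The condition `σ` forces, for `s = true`, that a generic element of `(ω)^2` lies in the value
of the tree at the given level, and for `s = false` that it does not. A union is forced by forcing
one of its members, and an intersection is refuted by refuting one of its members. -/
def Forces : LabelledTree → ℕ → List Bool → Bool → Prop
  | T, 0, σ, s => ForcesClopen (T []) σ s
  | T, α + 1, σ, s => match T [] with
    | some .union => Decides (fun τ => ∃ a, T [a] ≠ none ∧ Forces (T.subtree a) α τ true) σ s
    | some .inter => Decides (fun τ => ∃ a, T [a] ≠ none ∧ Forces (T.subtree a) α τ false) σ (!s)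
    | ℓ => ForcesClopen ℓ σ s

/-- The condition `σ` decides membership in the value of one of the subtrees at level one as `d`. -/
def ForcesChild (T : LabelledTree) (α : ℕ) (d : Bool) (σ : List Bool) : Prop :=
  ∃ a, T [a] ≠ none ∧ (T.subtree a).Forces α σ d

variable {T : LabelledTree} {α : ℕ} {σ : List Bool} {s : Bool}

theorem forces_succ_iff_of_union (h : T [] = some .union) :
    T.Forces (α + 1) σ s ↔ Decides (T.ForcesChild α true) σ s := by
  rw [Forces, h]
  rfl

theorem forces_succ_iff_of_inter (h : T [] = some .inter) :
    T.Forces (α + 1) σ s ↔ Decides (T.ForcesChild α false) σ (!s) := by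
  rw [Forces, h]
  rfl

theorem forces_iff_of_leaf (hunion : T [] ≠ some .union) (hinter : T [] ≠ some .inter) :
    T.Forces α σ s ↔ ForcesClopen (T []) σ s := by
  cases α with
  | zero => rfl
  | succ α => rw [Forces]; split <;> simp_all

theorem extensionClosed_forcesChild_of_forces {d : Bool}
    (h : ∀ a, ExtensionClosed fun σ => (T.subtree a).Forces α σ d) :
    ExtensionClosed (T.ForcesChild α d) :=
  fun _ _ hστ ⟨a, ha, hσ⟩ => ⟨a, ha, h a hστ hσ⟩

theorem extensionClosed_forces (T : LabelledTree) (α : ℕ) (s : Bool) :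
    ExtensionClosed fun σ => T.Forces α σ s := by
  induction α generalizing T s with
  | zero => exact extensionClosed_forcesClopen _ s
  | succ α ih =>
    have hchild (d : Bool) := extensionClosed_forcesChild_of_forces fun a => ih (T.subtree a) d
    by_cases hunion : T [] = some .union
    · simpa only [forces_succ_iff_of_union hunion] using extensionClosed_decides (hchild true) s
    by_cases hinter : T [] = some .inter
    · simpa only [forces_succ_iff_of_inter hinter] using extensionClosed_decides (hchild false) _
    simpa only [forces_iff_of_leaf hunion hinter] using extensionClosed_forcesClopen _ s

theorem extensionClosed_forcesChild (T : LabelledTree) (α : ℕ) (d : Bool) :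
    ExtensionClosed (T.ForcesChild α d) :=
  extensionClosed_forcesChild_of_forces fun a => extensionClosed_forces (T.subtree a) α d

theorem exists_prefix_forces (T : LabelledTree) (α : ℕ) (σ : List Bool) :
    ∃ τ, σ <+: τ ∧ ∃ s, T.Forces α τ s := by
  by_cases hunion : T [] = some .union
  · cases α with
    | zero => exact exists_prefix_forcesClopen _ σ
    | succ α => simpa only [forces_succ_iff_of_union hunion] using exists_prefix_decides _ σ
  by_cases hinter : T [] = some .inter
  · cases α with
    | zero => exact exists_prefix_forcesClopen _ σ
    | succ α =>
      obtain ⟨τ, hτ, s, hs⟩ := exists_prefix_decides (T.ForcesChild α false) σ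
      exact ⟨τ, hτ, !s, (forces_succ_iff_of_inter hinter).2 (by rwa [Bool.not_not])⟩
  simpa only [forces_iff_of_leaf hunion hinter] using exists_prefix_forcesClopen _ σ

/-- A bounded and hence decidable version of `ForcesChild`: the subtree is found among those with
index below the length of `σ`. -/
def ForcesChildWithin (T : LabelledTree) (α : ℕ) (d : Bool) (σ : List Bool) : Prop :=
  ∃ a < σ.length, T [a] ≠ none ∧ (T.subtree a).Forces α σ d

theorem ForcesChildWithin.forcesChild {d : Bool}
    (h : T.ForcesChildWithin α d σ) : T.ForcesChild α d σ :=
  h.imp fun _ => And.right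

theorem extensionClosed_forcesChildWithin (T : LabelledTree) (α : ℕ) (d : Bool) :
    ExtensionClosed (T.ForcesChildWithin α d) := fun _ _ h ⟨a, hal, ha, hσ⟩ =>
  ⟨a, hal.trans_le h.length_le, ha, extensionClosed_forces _ α d h hσ⟩

theorem ForcesChild.exists_prefix_forcesChildWithin {d : Bool}
    (h : T.ForcesChild α d σ) : ∃ τ, σ <+: τ ∧ T.ForcesChildWithin α d τ := by
  obtain ⟨a, ha, hσ⟩ := h
  have hpre := List.prefix_append σ (List.replicate (a + 1) false)
  exact ⟨_, hpre, a, by simp; omega, ha, extensionClosed_forces _ α d hpre hσ⟩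

/-- The condition `σ` decides membership in the value of the tree at all levels below `n`. -/
def DecidesBelow (T : LabelledTree) (n : ℕ) (σ : List Bool) : Prop :=
  ∀ β < n, ∃ s, T.Forces β σ s

theorem extensionClosed_decidesBelow (T : LabelledTree) (n : ℕ) :
    ExtensionClosed (T.DecidesBelow n) := fun _ _ h hσ β hβ =>
  (hσ β hβ).imp fun s => extensionClosed_forces T β s h

theorem exists_prefix_decidesBelow (T : LabelledTree) (n : ℕ) (σ : List Bool) :
    ∃ τ, σ <+: τ ∧ T.DecidesBelow n τ := by
  induction n with
  | zero => exact ⟨σ, List.prefix_rfl, fun β hβ => absurd hβ β.not_lt_zero⟩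
  | succ n ih =>
    obtain ⟨τ, hστ, hτ⟩ := ih
    obtain ⟨ρ, hτρ, hρ⟩ := exists_prefix_forces T n τ
    exact ⟨ρ, hστ.trans hτρ, Nat.forall_lt_succ_right.2
      ⟨extensionClosed_decidesBelow T n hτρ hτ, hρ⟩⟩

/-- The part of `T` above the string `ν`. -/
def above (T : LabelledTree) (ν : List ℕ) : LabelledTree := fun ρ => T (ν ++ ρ)

theorem above_subtree (T : LabelledTree) (a : ℕ) (ν : List ℕ) :
    (T.above ν).subtree a = T.above (ν ++ [a]) := by
  funext ρ
  simp [above, subtree]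

/-- The initial segments of `q` decide membership in the values of all parts of `T` at all levels
below `n`. -/
def IsGeneric (T : LabelledTree) (n : ℕ) (q : ℕ → ℕ) : Prop :=
  ∀ ν, ∃ l, (T.above ν).DecidesBelow n (initSeg q l)

theorem IsGeneric.subtree {n : ℕ} {q : ℕ → ℕ} (h : T.IsGeneric n q) (a : ℕ) :
    (T.subtree a).IsGeneric n q :=
  fun ν => h (a :: ν)

theorem exists_initSeg_iff_of_decides {C : List Bool → Prop} (hC : ExtensionClosed C) {q : ℕ → ℕ}
    {l : ℕ} (h : Decides C (initSeg q l) s) : (∃ m, C (initSeg q m)) ↔ s = true := by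
  cases s with
  | true => exact iff_of_true ⟨l, h⟩ rfl
  | false =>
    refine iff_of_false (fun ⟨m, hm⟩ => ?_) Bool.false_ne_true
    exact h _ (initSeg_prefix_initSeg q (le_max_left l m))
      (hC (initSeg_prefix_initSeg q (le_max_right l m)) hm)

theorem IsGeneric.exists_forcesChild_iff {n : ℕ} {q : Partition 2} (hq : T.IsGeneric n q.1)
    (hα : α < n) (htruth : ∀ a l s, (T.subtree a).Forces α (initSeg q.1 l) s →
      (q ∈ (T.subtree a).value 2 α ↔ s = true)) (d : Bool) :
    (∃ l, T.ForcesChild α d (initSeg q.1 l)) ↔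
      ∃ a, T [a] ≠ none ∧ (q ∈ (T.subtree a).value 2 α ↔ d = true) := by
  constructor
  · rintro ⟨l, a, ha, h⟩
    exact ⟨a, ha, htruth a l d h⟩
  · rintro ⟨a, ha, h⟩
    obtain ⟨l, hl⟩ := hq [a]
    obtain ⟨s, hs⟩ := hl α hα
    obtain rfl : s = d := Bool.eq_iff_iff.2 ((htruth a l s hs).symm.trans h)
    exact ⟨l, a, ha, hs⟩

theorem IsGeneric.mem_value_iff {n : ℕ} {q : Partition 2} (hq : T.IsGeneric n q.1) (hα : α ≤ n)
    {l : ℕ} (h : T.Forces α (initSeg q.1 l) s) : q ∈ T.value 2 α ↔ s = true := by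
  induction α generalizing T l s with
  | zero => exact h.mem_clopenSet_iff
  | succ α ih =>
    have hchild := hq.exists_forcesChild_iff hα fun a _ _ =>
      ih (hq.subtree a) (Nat.le_of_succ_le hα)
    by_cases hunion : T [] = some .union
    · rw [forces_succ_iff_of_union hunion] at h
      rw [value_succ_of_union hunion,
        ← exists_initSeg_iff_of_decides (extensionClosed_forcesChild T α true) h, hchild true]
      simp only [Set.mem_ofPred_eq, iff_true]
    by_cases hinter : T [] = some .inter
    · rw [forces_succ_iff_of_inter hinter] at h
      have := exists_initSeg_iff_of_decides (extensionClosed_forcesChild T α false) h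
      rw [hchild false] at this
      rw [value_succ_of_inter hinter, ← Bool.not_eq_false s, ← Bool.not_eq_true', ← this]
      simp
    · rw [forces_iff_of_leaf hunion hinter] at h
      rw [value_of_leaf hunion hinter]
      exact h.mem_clopenSet_iff

end LabelledTree

end Forces

/-! ### The complexity of forcing -/

section ForcesClopenComplexity

theorem primrec_labelString : Primrec labelString := by
  have hcases : Primrec fun ℓ : Label =>
      ((Label.equivSum ℓ).casesOn (fun _ => []) fun y => y.casesOn id id : List ℕ) :=
    Primrec.sumCasesOn Primrec.of_equiv (Primrec.const []).to₂
      (Primrec.sumCasesOn Primrec.snd Primrec.snd.to₂ Primrec.snd.to₂).to₂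
  refine (Primrec.option_getD.comp (Primrec.option_map Primrec.id (hcases.comp Primrec.snd).to₂)
    (Primrec.const [])).of_eq ?_
  rintro (- | - | - | - | - | ρ | ρ) <;> rfl

theorem labelHolds_iff {ℓ : Option Label} {σ : List Bool} :
    LabelHolds ℓ σ ↔ ℓ = some .whole ∨
      (ℓ = some (.cyl (labelString ℓ)) ∧ labelString ℓ <+: σ.map Bool.toNat) ∨
      (ℓ = some (.compl (labelString ℓ)) ∧ ¬ labelString ℓ <+: σ.map Bool.toNat) := by
  rcases ℓ with - | - | - | - | - | ρ | ρ <;> simp [LabelHolds, labelString]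

theorem primrecPred_labelHolds :
    PrimrecPred fun x : Option Label × List Bool => LabelHolds x.1 x.2 := by
  have hstring : Primrec fun x : Option Label × List Bool => labelString x.1 :=
    primrec_labelString.comp Primrec.fst
  have hcyl : Primrec Label.cyl :=
    (Primrec.of_equiv_symm (e := Label.equivSum)).comp (Primrec.sumInr.comp Primrec.sumInl)
  have hcompl : Primrec Label.compl :=
    (Primrec.of_equiv_symm (e := Label.equivSum)).comp (Primrec.sumInr.comp Primrec.sumInr)
  have hpre : PrimrecPred fun x : Option Label × List Bool =>
      labelString x.1 <+: x.2.map Bool.toNat :=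
    primrecRel_isPrefix.comp hstring
      (Primrec.list_map Primrec.snd ((Primrec.dom_bool Bool.toNat).comp Primrec.snd).to₂)
  refine PrimrecPred.of_eq (PrimrecPred.or (Primrec.eq.comp Primrec.fst (Primrec.const _))
    (PrimrecPred.or (PrimrecPred.and (Primrec.eq.comp Primrec.fst ?_) hpre)
      (PrimrecPred.and (Primrec.eq.comp Primrec.fst ?_) hpre.not))) fun _ => labelHolds_iff.symm
  · exact Primrec.option_some.comp (hcyl.comp hstring)
  · exact Primrec.option_some.comp (hcompl.comp hstring)

theorem primrecPred_forcesClopen (s : Bool) :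
    PrimrecPred fun x : Option Label × List Bool => ForcesClopen x.1 x.2 s := by
  have hlength : PrimrecPred fun x : Option Label × List Bool =>
      (labelString x.1).length ≤ x.2.length :=
    Primrec.nat_le.comp (Primrec.list_length.comp (primrec_labelString.comp Primrec.fst))
      (Primrec.list_length.comp Primrec.snd)
  cases s with
  | true => exact (hlength.and primrecPred_labelHolds).of_eq fun _ => by simp [ForcesClopen]
  | false => exact (hlength.and primrecPred_labelHolds.not).of_eq fun _ => by simp [ForcesClopen]

end ForcesClopenComplexity

section ForcesComplexity

variable {α β : Type*} [Primcodable α] [Primcodable β]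

theorem ComputablePredIn.decides_exists_jump {X : Set ℕ} {C : (α × List Bool) × β → Prop}
    (hC : ComputablePredIn {charFun X} C) (s : Bool) :
    ComputablePredIn {charFun (jump X)} fun x : α × List Bool =>
      Decides (fun τ => ∃ b, C ((x.1, τ), b)) x.2 s := by
  cases s with
  | true => exact hC.exists_jump
  | false =>
    have hpre : PrimrecPred fun x : (α × List Bool) × (List Bool × β) => x.1.2 <+: x.2.1 :=
      primrecRel_isPrefix.comp (Primrec.snd.comp Primrec.fst) (Primrec.fst.comp Primrec.snd)
    have hext : Primrec fun x : (α × List Bool) × (List Bool × β) => ((x.1.1, x.2.1), x.2.2) :=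
      ((Primrec.fst.comp Primrec.fst).pair (Primrec.fst.comp Primrec.snd)).pair
        (Primrec.snd.comp Primrec.snd)
    refine ((ComputablePredIn.of_primrecPred hpre).and
      (hC.comp hext.computableIn)).exists_jump.not.of_iff fun x => ?_
    simp only [Decides, Prod.exists, not_exists, not_and]
    exact forall_congr' fun τ => forall_comm

namespace LabelledTree

variable {T : LabelledTree} {O : Set (ℕ →. ℕ)}

theorem computablePredIn_forces_child {n : ℕ} {d : Bool} (hT : ComputableIn O T)
    (h : ComputablePredIn O fun x : List ℕ × List Bool => (T.above x.1).Forces n x.2 d) :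
    ComputablePredIn O fun x : (List ℕ × List Bool) × ℕ =>
      T.above x.1.1 [x.2] ≠ none ∧ ((T.above x.1.1).subtree x.2).Forces n x.1.2 d := by
  have hnode : Primrec fun x : (List ℕ × List Bool) × ℕ => x.1.1 ++ [x.2] :=
    Primrec.list_append.comp (Primrec.fst.comp Primrec.fst)
      (Primrec.list_cons.comp Primrec.snd (Primrec.const []))
  have hnone : PrimrecPred fun ℓ : Option Label => ℓ ≠ none :=
    (Primrec.eq.comp Primrec.id (Primrec.const none)).not
  simp only [above_subtree]
  exact ((ComputablePredIn.of_primrecPred hnone).comp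
    (computableIn_comp hT hnode.computableIn)).and
      (h.comp (hnode.pair (Primrec.snd.comp Primrec.fst)).computableIn)

theorem computablePredIn_forces (hT : Computable T) (n : ℕ) (s : Bool) :
    ComputablePredIn {charFun (emptyJump n)} fun x : List ℕ × List Bool =>
      (T.above x.1).Forces n x.2 s := by
  have hroot (O) : ComputableIn O fun x : List ℕ × List Bool => T.above x.1 [] := by
    simpa [above] using computableIn_comp hT.computableIn Primrec.fst.computableIn
  have hclopen (O) (s : Bool) : ComputablePredIn O fun x : List ℕ × List Bool =>
      ForcesClopen (T.above x.1 []) x.2 s :=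
    (ComputablePredIn.of_primrecPred (primrecPred_forcesClopen s)).comp
      (computableIn_pair (hroot O) ComputableIn.snd)
  induction n generalizing s with
  | zero => exact hclopen _ s
  | succ n ih =>
    have hlabel (ℓ : Label) : ComputablePredIn {charFun (emptyJump (n + 1))}
        fun x : List ℕ × List Bool => T.above x.1 [] = some ℓ :=
      (ComputablePredIn.of_primrecPred
        (Primrec.eq.comp Primrec.id (Primrec.const (some ℓ)))).comp (hroot _)
    have hchild (d t : Bool) : ComputablePredIn {charFun (emptyJump (n + 1))}
        fun x : List ℕ × List Bool => Decides ((T.above x.1).ForcesChild n d) x.2 t := by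
      rw [emptyJump_succ]
      exact (computablePredIn_forces_child hT.computableIn (ih d)).decides_exists_jump t
    refine (((hlabel .union).imp (hchild true s)).and <| ((hlabel .inter).imp (hchild false !s)).and
      <| ((hlabel .union).not.and (hlabel .inter).not).imp (hclopen _ s)).of_iff fun x => ?_
    by_cases hunion : T.above x.1 [] = some .union
    · simp [forces_succ_iff_of_union hunion, hunion]
    by_cases hinter : T.above x.1 [] = some .inter
    · simp [forces_succ_iff_of_inter hinter, hinter]
    simp [forces_iff_of_leaf hunion hinter, hunion, hinter]

theorem computablePredIn_decidesBelow (hT : Computable T) (n : ℕ) :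
    ComputablePredIn {charFun (emptyJump n)} fun x : List ℕ × List Bool =>
      (T.above x.1).DecidesBelow (n + 1) x.2 := by
  have htop (n : ℕ) := (computablePredIn_forces hT n true).or (computablePredIn_forces hT n false)
  induction n with
  | zero => exact (htop 0).of_iff fun x => by simp [DecidesBelow, Bool.exists_bool, or_comm]
  | succ n ih =>
    have ih' := ih.jump
    rw [← emptyJump_succ] at ih'
    refine (ih'.and (htop (n + 1))).of_iff fun x => ?_
    simp only [DecidesBelow, Nat.forall_lt_succ_right (n := n + 1), Bool.exists_bool, or_comm]

theorem computablePredIn_forcesChildWithin (hT : Computable T) (n : ℕ) (d : Bool) :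
    ComputablePredIn {charFun (emptyJump n)} fun x : List ℕ × List Bool =>
      (T.above x.1).ForcesChildWithin n d x.2 :=
  (computablePredIn_forces_child hT.computableIn (computablePredIn_forces hT n d)).exists_lt
    (Primrec.list_length.comp Primrec.snd).computableIn

end LabelledTree

end ForcesComplexity

/-! ### The dichotomy -/

section Dichotomy

namespace LabelledTree

variable {T : LabelledTree} {n : ℕ}

/-- The requirements for `IsGeneric`, numbered by the codes of the strings. -/
def NodeDecidesBelow (T : LabelledTree) (n s : ℕ) (σ : List Bool) : Prop :=
  (T.above (Denumerable.ofNat (List ℕ) s)).DecidesBelow n σ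

theorem computablePredIn_nodeDecidesBelow (hT : Computable T) (n : ℕ) :
    ComputablePredIn {charFun (emptyJump n)} fun x : ℕ × List Bool =>
      T.NodeDecidesBelow (n + 1) x.1 x.2 :=
  (computablePredIn_decidesBelow hT n).comp
    (((Primrec.ofNat (List ℕ)).comp Primrec.fst).pair Primrec.snd).computableIn

theorem isGeneric_of_nodeDecidesBelow {q : ℕ → ℕ}
    (h : ∀ s, ∃ l, T.NodeDecidesBelow n s (initSeg q l)) : T.IsGeneric n q := fun ν => by
  simpa only [NodeDecidesBelow, Denumerable.ofNat_encode] using h (encode ν)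

theorem exists_partition_subset_value (hT : Computable T) (hroot : T [] = some .union)
    (hforce : ∀ N, ∃ σ, LateSecondBlock N σ ∧ T.ForcesChild (n + 1) true σ) :
    ∃ x : Partition ⊤, ComputableFrom (emptyJump (n + 1)) x ∧
      coarsenings x 2 ⊆ T.value 2 (n + 2) := by
  have hM : ComputablePredIn {charFun (emptyJump (n + 1))} (T.ForcesChildWithin (n + 1) true) :=
    (computablePredIn_forcesChildWithin hT (n + 1) true).comp
      ((Primrec.const []).pair Primrec.id).computableIn
  have hD := computablePredIn_nodeDecidesBelow hT n
  have hMe := extensionClosed_forcesChildWithin T (n + 1) true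
  have hlate (N) : ∃ σ, LateSecondBlock N σ ∧ T.ForcesChildWithin (n + 1) true σ := by
    obtain ⟨σ, hσN, hσ⟩ := hforce N
    obtain ⟨τ, hστ, hτ⟩ := hσ.exists_prefix_forcesChildWithin
    exact ⟨τ, extensionClosed_lateSecondBlock N hστ hσN, hτ⟩
  obtain ⟨x, hx, hmeet⟩ := exists_partition_forall_coarsenings_meet
    (D := T.NodeDecidesBelow (n + 1)) hM (emptyJump_succ n ▸ hD.jump) hMe
    (fun s => extensionClosed_decidesBelow _ _) hlate
    fun s => hMe.denseIn (exists_prefix_decidesBelow _ _)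
  refine ⟨x, hx, fun q hq => ?_⟩
  obtain ⟨⟨l, a, -, ha, hforces⟩, hdecides⟩ := hmeet q hq
  rw [value_succ_of_union hroot]
  exact ⟨a, ha, (((isGeneric_of_nodeDecidesBelow hdecides).subtree a).mem_value_iff le_rfl
    hforces).2 rfl⟩

theorem exists_prefix_forcesChild_false {σ : List Bool} (hinter : T [] = some .inter)
    (h : ¬ T.Forces (n + 1) σ true) : ∃ τ, σ <+: τ ∧ T.ForcesChild n false τ := by
  rw [forces_succ_iff_of_inter hinter] at h
  simpa [Decides] using h

theorem IsGeneric.notMem_value {q : Partition 2} {N l : ℕ} (hq : T.IsGeneric (n + 1) q.1)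
    (hl : LateSecondBlock N (initSeg q.1 l))
    (hforce : ∀ σ, LateSecondBlock N σ → ¬ T.Forces (n + 1) σ true)
    (hinter : T [] = some .inter → ∃ m, T.ForcesChild n false (initSeg q.1 m)) :
    q ∉ T.value 2 (n + 1) := by
  suffices ∃ m, T.Forces (n + 1) (initSeg q.1 m) false by
    obtain ⟨m, hm⟩ := this
    simp [hq.mem_value_iff le_rfl hm]
  by_cases hroot : T [] = some .inter
  · obtain ⟨m, hm⟩ := hinter hroot
    exact ⟨m, (forces_succ_iff_of_inter hroot).2 hm⟩
  by_cases hunion : T [] = some .union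
  · refine ⟨l, (forces_succ_iff_of_union hunion).2 fun τ hτ hchild => ?_⟩
    exact hforce τ (extensionClosed_lateSecondBlock N hτ hl)
      ((forces_succ_iff_of_union hunion).2 hchild)
  · obtain ⟨m, hm⟩ := hq []
    obtain ⟨s, hs⟩ := hm 0 n.succ_pos
    have hs' : T.Forces (n + 1) (initSeg q.1 m) s := (forces_iff_of_leaf hunion hroot).2 hs
    cases s with
    | false => exact ⟨m, hs'⟩
    | true =>
      exact absurd (extensionClosed_forces T _ _ (initSeg_prefix_initSeg _ (le_max_right l m)) hs')
        (hforce _ (extensionClosed_lateSecondBlock N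
          (initSeg_prefix_initSeg _ (le_max_left l m)) hl))

/-- If the `a`-th subtree at level one is an intersection, then `σ` refutes one of its members. -/
def RefutesInter (T : LabelledTree) (n a : ℕ) (σ : List Bool) : Prop :=
  T [a] = some .inter → (T.subtree a).ForcesChildWithin n false σ

theorem extensionClosed_refutesInter (T : LabelledTree) (n a : ℕ) :
    ExtensionClosed (T.RefutesInter n a) := fun _ _ h hσ ha =>
  extensionClosed_forcesChildWithin _ n false h (hσ ha)

theorem computablePredIn_refutesInter (hT : Computable T) (n : ℕ) :
    ComputablePredIn {charFun (emptyJump n)} fun x : ℕ × List Bool => T.RefutesInter n x.1 x.2 := by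
  have hnode : Primrec fun x : ℕ × List Bool => [x.1] :=
    Primrec.list_cons.comp Primrec.fst (Primrec.const [])
  exact ((ComputablePredIn.of_primrecPred (Primrec.eq.comp Primrec.id (Primrec.const _))).comp
    (computableIn_comp hT.computableIn hnode.computableIn)).imp
      ((computablePredIn_forcesChildWithin hT n false).comp (hnode.pair Primrec.snd).computableIn)

theorem denseIn_refutesInter {N a : ℕ}
    (hforce : ∀ σ, LateSecondBlock N σ → ¬ T.ForcesChild (n + 1) true σ) :
    DenseIn (LateSecondBlock N) (T.RefutesInter n a) := by
  intro σ hσ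
  by_cases ha : T [a] = some .inter
  · obtain ⟨τ, hστ, hτ⟩ := exists_prefix_forcesChild_false (T := T.subtree a) ha
      fun h => hforce σ hσ ⟨a, by simp [ha], h⟩
    obtain ⟨ρ, hτρ, hρ⟩ := hτ.exists_prefix_forcesChildWithin
    have hσρ := hστ.trans hτρ
    exact ⟨ρ, hσρ, extensionClosed_lateSecondBlock N hσρ hσ, fun _ => hρ⟩
  · exact ⟨σ, List.prefix_rfl, hσ, fun h => absurd h ha⟩

theorem exists_partition_subset_compl_value {N : ℕ} (hT : Computable T)
    (hroot : T [] = some .union)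
    (hforce : ∀ σ, LateSecondBlock N σ → ¬ T.ForcesChild (n + 1) true σ) :
    ∃ x : Partition ⊤, ComputableFrom (emptyJump n) x ∧
      coarsenings x 2 ⊆ (T.value 2 (n + 2))ᶜ := by
  have hMe := extensionClosed_lateSecondBlock N
  have hDe (s) : ExtensionClosed (T.NodeDecidesBelow (n + 1) s) :=
    extensionClosed_decidesBelow _ _
  have hDdense (s) : DenseIn (LateSecondBlock N) (T.NodeDecidesBelow (n + 1) s) :=
    hMe.denseIn (exists_prefix_decidesBelow _ _)
  have hlate (M) : ∃ σ, LateSecondBlock M σ ∧ LateSecondBlock N σ :=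
    ⟨_, (lateSecondBlock_replicate_append (max M N)).of_le (le_max_left M N),
      (lateSecondBlock_replicate_append (max M N)).of_le (le_max_right M N)⟩
  obtain ⟨x, hx, hmeet⟩ := exists_partition_forall_coarsenings_meet
    (D := fun s σ => T.NodeDecidesBelow (n + 1) s σ ∧ T.RefutesInter n s σ)
    (.of_primrecPred (primrecPred_lateSecondBlock N))
    ((computablePredIn_nodeDecidesBelow hT n).and (computablePredIn_refutesInter hT n)) hMe
    (fun s => (hDe s).and (extensionClosed_refutesInter T n s))
    hlate fun s => (hDdense s).and (hDe s) (denseIn_refutesInter hforce)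
  refine ⟨x, hx, fun q hq => ?_⟩
  obtain ⟨⟨l, hl⟩, hmeet⟩ := hmeet q hq
  have hgeneric : T.IsGeneric (n + 1) q.1 :=
    isGeneric_of_nodeDecidesBelow fun s => (hmeet s).imp fun _ => And.left
  rw [value_succ_of_union hroot]
  rintro ⟨a, ha, hmem⟩
  refine (hgeneric.subtree a).notMem_value hl (fun σ hσ h => hforce σ hσ ⟨a, ha, h⟩)
    (fun hinter => ?_) hmem
  obtain ⟨m, -, hm⟩ := hmeet a
  exact ⟨m, (hm hinter).forcesChild⟩

end LabelledTree

end Dichotomy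

end DualRamsey

theorem mainTheorem6 (n : ℕ) (T : DualRamsey.LabelledTree) (hT : Computable T)
    (R : Set (DualRamsey.Partition 2))
    (hR : DualRamsey.BorelCode 2 DualRamsey.Kind.sigma (n + 2) T R) :
    (∃ x : DualRamsey.Partition ⊤, DualRamsey.ComputableFrom (DualRamsey.emptyJump n) x ∧
        DualRamsey.coarsenings x 2 ⊆ Rᶜ) ∨
      (∃ x : DualRamsey.Partition ⊤, DualRamsey.ComputableFrom (DualRamsey.emptyJump (n + 1)) x ∧
        DualRamsey.coarsenings x 2 ⊆ R) := by
  have hroot := hR.root_eq_union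
  obtain rfl := hR.eq_value le_rfl
  by_cases hforce : ∀ N, ∃ σ, DualRamsey.LateSecondBlock N σ ∧ T.ForcesChild (n + 1) true σ
  · exact .inr (DualRamsey.LabelledTree.exists_partition_subset_value hT hroot hforce)
  · push Not at hforce
    obtain ⟨N, hN⟩ := hforce
    exact .inl (DualRamsey.LabelledTree.exists_partition_subset_compl_value hT hroot hN)
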